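/- Let $\mathbb{T}^2=[0,1]^2$ be the periodic torus. For $s\in\mathbb{R}$ let $H^s(\mathbb{T}^2)$ be the space of real mean-free series $u=\sum_{\mathbf{k}\in\mathbb{Z}^2\setminus\{0\}}c_{\mathbf{k}}e^{2\pi i\mathbf{k}\cdot\mathbf{x}}$, $\overline{c_{\mathbf{k}}}=c_{-\mathbf{k}}$, with $\|u\|_{H^s}^2=\sum_{\mathbf{k}}\|\mathbf{k}\|^{2s}|c_{\mathbf{k}}|^2<\infty$. For $(a,b)\in\mathbb{R}^2$ write $(a,b)^\perp=(-b,a)$. Fix $m>1$, $\kappa>0$, $T>0$, and let $H$ be the space of divergence-free flows $\mathbf{v}=\sum_{\mathbf{k}\neq 0}v_{\mathbf{k}}\frac{\mathbf{k}^\perp}{\|\mathbf{k}\|}e^{2\pi i\mathbf{k}\cdot\mathbf{x}}$ with $\overline{v_{\mathbf{k}}}=-v_{-\mathbf{k}}$ and $\sum_{\mathbf{k}}\|\mathbf{k}\|^{2m}|v_{\mathbf{k}}|^2<\infty$. For $\mathbf{v}\in H$ and $\theta_0\in H^m(\mathbb{T}^2)$, a solution of $$\partial_t\theta=-\mathbf{v}\cdot\nabla\theta+\kappa\Delta\theta,\qquad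 \theta(0)=\theta_0,$$ means a function $\theta\in L^2_{loc}([0,\infty);H^{m+1}(\mathbb{T}^2))\cap L^\infty([0,\infty);H^m(\mathbb{T}^2))\cap C([0,\infty);H^m(\mathbb{T}^2))$ with $\partial_t\theta\in L^2_{loc}([0,\infty);H^{m-1}(\mathbb{T}^2))$ and $\theta(0)=\theta_0$ such that for all $\phi\in H^1(\mathbb{T}^2)$ and almost all $t\in[0,\infty)$ $$\langle\partial_t\theta,\phi\rangle_{H^{-1}\times H^1}+\langle\mathbf{v}\cdot\nabla\theta,\phi\rangle_{L^2(\mathbb{T}^2)}+\kappa\langle\nabla\theta,\nabla\phi\rangle_{L^2(\mathbb{T}^2)}=0 .$$ Let $\theta_0^{(1)},\theta_0^{(2)}\in H^m(\mathbb{T}^2)$ satisfy $$\left(\nabla\theta_0^{(1)}(\mathbf{x})\right)^\perp\cdot\nabla\theta_0^{(2)}(\mathbf{x})\neq 0\quad\text{for almost all }\mathbf{x}\in\mathbb{T}^2 .$$ **Lemma.** Let $\mathbf{v},\tilde{\mathbf{v}}\in H$, and for $i=1,2$ let $\theta^{(i)}$ and $\tilde\theta^{(i)}$ be solutions with initial condition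 $\theta_0^{(i)}$ for the flows $\mathbf{v}$ and $\tilde{\mathbf{v}}$ respectively. If $$\left\|(\theta^{(1)},\theta^{(2)})-(\tilde\theta^{(1)},\tilde\theta^{(2)})\right\|_{L^2([0,T]\times\mathbb{T}^2)^2}=0,$$ then $\mathbf{v}=\tilde{\mathbf{v}}$. In other words, the paired solution map $\tilde{\mathcal{S}}:H\to L^2([0,T]\times\mathbb{T}^2)^2$, which assigns to each flow $\mathbf{v}$ the pair of its solutions with initial conditions $\theta_0^{(1)},\theta_0^{(2)}$, is injective. -/

import Mathlib

open MeasureTheory Set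
open scoped ComplexConjugate ENNReal ContDiff

noncomputable section

namespace AdvDiff

/-! ### The torus, Fourier series and gradients -/

/-- The periodic domain `𝕋² = (ℝ/ℤ)²`. -/
abbrev Torus : Type := UnitAddTorus (Fin 2)

/-- Lebesgue measure on `𝕋² = [0,1]²` (total mass one). -/
abbrev torusMeasure : Measure Torus :=
  Measure.pi fun _ : Fin 2 => (AddCircle.haarAddCircle : Measure UnitAddCircle)

/-- The frequencies `𝐤 ∈ ℤ²`. -/
abbrev Freq : Type := Fin 2 → ℤ

/-- The Euclidean length `‖𝐤‖` of a frequency. -/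
def freqNorm (k : Freq) : ℝ := Real.sqrt ((k 0 : ℝ) ^ 2 + (k 1 : ℝ) ^ 2)

/-- `(a, b)^⊥ = (-b, a)`. -/
def perp {R : Type*} [Neg R] (a : Fin 2 → R) : Fin 2 → R := ![-a 1, a 0]

/-- The space `ℓ²(ℤ²; ℂ)`. -/
abbrev EllTwo : Type := lp (fun _ : Freq => ℂ) 2

open Classical in
/-- The sum in `L²(𝕋²; ℂ)` of the Fourier series `∑ c_𝐤 e^{2πi 𝐤·𝐱}`, for a square summable
family of coefficients (and zero otherwise). -/
def fourierSum (c : Freq → ℂ) : Torus → ℂ :=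
  if h : Memℓp c 2 then
    (UnitAddTorus.mFourierBasis.repr.symm (⟨c, h⟩ : EllTwo) : Lp ℂ 2 torusMeasure)
  else 0

/-- The real-valued function with Fourier coefficients `c`; used for families with
`c_{-𝐤} = conj c_𝐤`, for which the Fourier series is real almost everywhere. -/
def realize (c : Freq → ℂ) : Torus → ℝ := fun x => (fourierSum c x).re

/-- Fourier coefficients of `∂_j u`, where `c` are those of `u`. -/
def derivCoeff (c : Freq → ℂ) (j : Fin 2) : Freq → ℂ :=
  fun k => 2 * (Real.pi : ℂ) * Complex.I * (k j : ℂ) * c k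

/-- The gradient `∇u(𝐱)` of the function `u` with Fourier coefficients `c`, defined for almost
every `𝐱` when `u ∈ H¹`. -/
def grad (c : Freq → ℂ) (x : Torus) : Fin 2 → ℝ := fun j => realize (derivCoeff c j) x

/-! ### The Sobolev spaces of mean-free real periodic functions -/

/-- The family `‖𝐤‖^s c_𝐤`. -/
def weighted (s : ℝ) (c : Freq → ℂ) : Freq → ℂ := fun k => ((freqNorm k ^ s : ℝ) : ℂ) * c k

/-- Coefficient families of elements of `H^s(𝕋²)`: mean-free, real, and with
`∑ ‖𝐤‖^{2s} |c_𝐤|² < ∞`. -/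
def sobolevSubmodule (s : ℝ) : Submodule ℝ (Freq → ℂ) where
  carrier := {c | c 0 = 0 ∧ (∀ k, c (-k) = conj (c k)) ∧ Memℓp (weighted s c) 2}
  zero_mem' := by
    refine ⟨rfl, fun k => by simp, ?_⟩
    have : weighted s 0 = 0 := by ext k; simp [weighted]
    rw [this]
    exact zero_memℓp
  add_mem' := by
    rintro a b ⟨ha0, har, has⟩ ⟨hb0, hbr, hbs⟩
    refine ⟨by simp [ha0, hb0], fun k => by simp [har, hbr], ?_⟩
    have : weighted s (a + b) = weighted s a + weighted s b := by
      ext k; simp [weighted, mul_add]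
    rw [this]
    exact has.add hbs
  smul_mem' := by
    rintro r a ⟨ha0, har, has⟩
    refine ⟨by simp [ha0], fun k => by simp [har], ?_⟩
    have : weighted s (r • a) = (r : ℂ) • weighted s a := by
      ext k; simp [weighted]; ring
    rw [this]
    exact has.const_smul (r : ℂ)

/-- The Sobolev space `H^s(𝕋²)`, `s ∈ ℝ`. -/
def Hs (s : ℝ) : Type := sobolevSubmodule s

instance (s : ℝ) : AddCommGroup (Hs s) := inferInstanceAs (AddCommGroup (sobolevSubmodule s))

/-- The Fourier coefficients `c_𝐤` of an element of `H^s`. -/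
def Hs.coeff {s : ℝ} (u : Hs s) : Freq → ℂ := Subtype.val u

/-- The map `u ↦ (‖𝐤‖^s c_𝐤)_𝐤` from `H^s` to `ℓ²`. -/
def Hs.toEllTwo (s : ℝ) : Hs s →+ EllTwo where
  toFun u := ⟨weighted s u.coeff, u.2.2.2⟩
  map_zero' := by
    ext k
    change weighted s (0 : Freq → ℂ) k = 0
    simp [weighted]
  map_add' u v := by
    ext k
    change weighted s (u.coeff + v.coeff) k = weighted s u.coeff k + weighted s v.coeff k
    simp [weighted, mul_add]

theorem freqNorm_pos {k : Freq} (hk : k ≠ 0) : 0 < freqNorm k := by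
  unfold freqNorm
  apply Real.sqrt_pos.2
  by_contra! h
  apply hk
  have h0 : (k 0 : ℝ) = 0 := by nlinarith [sq_nonneg (k 0 : ℝ), sq_nonneg (k 1 : ℝ)]
  have h1 : (k 1 : ℝ) = 0 := by nlinarith [sq_nonneg (k 0 : ℝ), sq_nonneg (k 1 : ℝ)]
  ext j
  fin_cases j
  · simpa using h0
  · simpa using h1

theorem Hs.toEllTwo_injective (s : ℝ) : Function.Injective (Hs.toEllTwo s) := by
  intro u v h
  apply Subtype.ext
  funext k
  by_cases hk : k = 0
  · subst hk
    exact u.2.1.trans v.2.1.symm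
  · have h1 : weighted s u.coeff k = weighted s v.coeff k :=
      congrFun (congrArg Subtype.val h) k
    have h2 : ((freqNorm k ^ s : ℝ) : ℂ) ≠ 0 :=
      Complex.ofReal_ne_zero.2 (Real.rpow_pos_of_pos (freqNorm_pos hk) s).ne'
    exact mul_left_cancel₀ h2 h1

/-- The norm `‖u‖²_{H^s} = ∑ ‖𝐤‖^{2s} |c_𝐤|²`. -/
instance (s : ℝ) : NormedAddCommGroup (Hs s) :=
  NormedAddCommGroup.induced (Hs s) EllTwo (Hs.toEllTwo s) (Hs.toEllTwo_injective s)

/-- The duality pairing `⟨g, φ⟩ = ∑ g_𝐤 conj φ_𝐤` between real periodic distributions and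
functions, which extends the inner product of `L²(𝕋²)`. -/
def pairing (g φ : Freq → ℂ) : ℝ := (∑' k, g k * conj (φ k)).re

/-! ### Divergence-free flows -/

/-- The space of mean-free divergence-free flows of regularity `H^m(𝕋²)`: the fields
`𝐯(𝐱) = ∑_{𝐤 ≠ 0} v_𝐤 (𝐤^⊥ / ‖𝐤‖) e^{2πi 𝐤·𝐱}` with `conj v_𝐤 = -v_{-𝐤}` and
`∑ ‖𝐤‖^{2m} |v_𝐤|² < ∞`. The unused entry `v_0` is set to zero. -/
@[ext]
structure Flow (m : ℝ) where
  coeff : Freq → ℂ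
  coeff_zero : coeff 0 = 0
  conj_coeff : ∀ k, conj (coeff k) = -coeff (-k)
  memℓp : Memℓp (weighted m coeff) 2

/-- Fourier coefficients of the `j`-th component of the flow. -/
def Flow.fieldCoeff {m : ℝ} (v : Flow m) (j : Fin 2) : Freq → ℂ :=
  fun k => v.coeff k * (((perp k j : ℤ) : ℂ) / (freqNorm k : ℂ))

/-- The flow as a vector field. -/
def Flow.field {m : ℝ} (v : Flow m) (x : Torus) : Fin 2 → ℝ :=
  fun j => realize (v.fieldCoeff j) x

/-! ### Weak solutions of the advection-diffusion equation -/

/-- `f ∈ L²_loc([0,∞); H^r)`. -/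
def MemL2Loc {r : ℝ} (f : ℝ → Hs r) : Prop :=
  ∀ R : ℝ, MemLp f 2 (volume.restrict (Icc 0 R))

/-- `g` is the weak (distributional) time derivative of `θ` on `(0,∞)`, tested on each spatial
Fourier mode. -/
def IsWeakTimeDeriv {s r : ℝ} (θ : ℝ → Hs s) (g : ℝ → Hs r) : Prop :=
  ∀ η : ℝ → ℝ, ContDiff ℝ ∞ η → HasCompactSupport η → tsupport η ⊆ Ioi 0 → ∀ k : Freq,
    ∫ t in Ioi (0 : ℝ), ((deriv η t : ℝ) : ℂ) * (θ t).coeff k =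
      -∫ t in Ioi (0 : ℝ), ((η t : ℝ) : ℂ) * (g t).coeff k

/-- `θ` is a weak solution on `[0,∞)` of `∂_t θ = -𝐯·∇θ + κ Δθ`, `θ(0) = θ₀`, with
`θ ∈ L²_loc([0,∞); H^{s+1}) ∩ L^∞([0,∞); H^s) ∩ C([0,∞); H^s)` and
`∂_t θ ∈ L²_loc([0,∞); H^{s-1})`. -/
structure IsSolution (κ : ℝ) {m s : ℝ} (v : Flow m) (θ₀ : Hs s) (θ : ℝ → Hs s) : Prop where
  initial : θ 0 = θ₀
  continuousOn : ContinuousOn θ (Ici 0)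
  bounded : MemLp θ ∞ (volume.restrict (Ici 0))
  regular : ∃ w : ℝ → Hs (s + 1), MemL2Loc w ∧
    ∀ᵐ t ∂volume.restrict (Ici (0 : ℝ)), (w t).coeff = (θ t).coeff
  weak_eq : ∃ g : ℝ → Hs (s - 1), MemL2Loc g ∧ IsWeakTimeDeriv θ g ∧
    ∀ φ : Hs 1, ∀ᵐ t ∂volume.restrict (Ici (0 : ℝ)),
      pairing (g t).coeff φ.coeff
        + ∫ x, (v.field x ⬝ᵥ grad (θ t).coeff x) * realize φ.coeff x ∂torusMeasure
        + κ * ∫ x, grad (θ t).coeff x ⬝ᵥ grad φ.coeff x ∂torusMeasure = 0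

/-! ### The paired solution map -/

/-- `L²([0,T] × 𝕋²)`. -/
abbrev SpaceTimeL2 (T : ℝ) : Type :=
  Lp ℝ 2 ((volume.restrict (Icc (0 : ℝ) T)).prod torusMeasure)

/-- `Θ ∈ L²([0,T] × 𝕋²)` is (the restriction to `[0,T]` of) the solution for the flow `v` and the
initial condition `θ₀`. -/
def IsSolutionL2 (κ T : ℝ) {m s : ℝ} (θ₀ : Hs s) (v : Flow m) (Θ : SpaceTimeL2 T) : Prop :=
  ∃ θ : ℝ → Hs s, IsSolution κ v θ₀ θ ∧
    ∀ᵐ t ∂volume.restrict (Icc (0 : ℝ) T), ∀ᵐ x ∂torusMeasure,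
      Θ (t, x) = realize (θ t).coeff x

/-- The graph of the paired solution map: `Θ` is the pair of solutions for the flow `v` and the
initial conditions `θ₀₁` and `θ₀₂`. -/
def IsPairedSolution (κ T : ℝ) {m s : ℝ} (θ₀₁ θ₀₂ : Hs s) (v : Flow m)
    (Θ : SpaceTimeL2 T × SpaceTimeL2 T) : Prop :=
  IsSolutionL2 κ T θ₀₁ v Θ.1 ∧ IsSolutionL2 κ T θ₀₂ v Θ.2

end AdvDiff

end

noncomputable section

namespace AdvDiff

/-! The flow can be read off from the equation at time `0`. Equality in `L²([0,T] × 𝕋²)` and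
continuity in time make the two solutions agree at every `t ∈ [0,T]` (`IsSolutionL2.exists_eqOn`),
so their weak time derivatives agree on `(0,T)` (`IsWeakTimeDeriv.ae_coeff_eq`). Subtracting the two
equations leaves only the advection terms: `(v - v')·∇θ(t)` is orthogonal to each nonconstant
trigonometric mode for almost every `t`. For a fixed mode this pairing is continuous in `t`, hence
it also vanishes at `t = 0`, where `θ` is the known datum.

The mean of `(v - v')·∇θ₀` vanishes because the flows are divergence-free. So `(v - v')·∇θ₀` is an
integrable function with zero Fourier coefficients and is zero almost everywhere
(`ae_field_dotProduct_grad_eq`). The two data give a 2×2 linear system for `v - v'` at almost every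
point, with determinant `(∇θ₀₁)^⊥·∇θ₀₂ ≠ 0`. -/

/-! ### Fourier series in `L²` and real-valued functions -/

/-- The Fourier isometry `ℓ²(ℤ²) ≃ L²(𝕋²)`. -/
def ellTwoEquiv : EllTwo ≃ₗᵢ[ℂ] Lp ℂ 2 torusMeasure := UnitAddTorus.mFourierBasis.repr.symm

theorem fourierSum_of_memℓp {c : Freq → ℂ} (h : Memℓp c 2) :
    fourierSum c = ellTwoEquiv (⟨c, h⟩ : EllTwo) := dif_pos h

theorem memLp_fourierSum (c : Freq → ℂ) : MemLp (fourierSum c) 2 torusMeasure := by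
  by_cases h : Memℓp c 2
  · rw [fourierSum_of_memℓp h]
    exact Lp.memLp _
  · have : fourierSum c = 0 := dif_neg h
    rw [this]
    exact MemLp.zero

theorem memLp_realize (c : Freq → ℂ) : MemLp (realize c) 2 torusMeasure :=
  (memLp_fourierSum c).re

theorem fourierSum_add {a b : Freq → ℂ} (ha : Memℓp a 2) (hb : Memℓp b 2) :
    fourierSum (a + b) =ᵐ[torusMeasure] fourierSum a + fourierSum b := by
  rw [fourierSum_of_memℓp (ha.add hb), fourierSum_of_memℓp ha, fourierSum_of_memℓp hb]
  have : (⟨a + b, ha.add hb⟩ : EllTwo) = ⟨a, ha⟩ + ⟨b, hb⟩ := rfl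
  rw [this, map_add]
  exact Lp.coeFn_add _ _

theorem memℓp_single (k : Freq) (α : ℂ) : Memℓp (Pi.single k α : Freq → ℂ) 2 :=
  (lp.single 2 k α : EllTwo).2

theorem fourierSum_single (k : Freq) (α : ℂ) :
    fourierSum (Pi.single k α) =ᵐ[torusMeasure] fun x => α * UnitAddTorus.mFourier k x := by
  have h := memℓp_single k α
  rw [fourierSum_of_memℓp h]
  have h1 : (⟨Pi.single k α, h⟩ : EllTwo) = α • lp.single 2 k (1 : ℂ) := by
    rw [← lp.single_smul, smul_eq_mul, mul_one]
    rfl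
  have h2 : ellTwoEquiv (lp.single 2 k (1 : ℂ)) = UnitAddTorus.mFourierLp 2 k := by
    rw [← UnitAddTorus.coe_mFourierBasis]
    exact HilbertBasis.repr_symm_single _ _
  rw [h1, map_smul, h2]
  filter_upwards [Lp.coeFn_smul α (UnitAddTorus.mFourierLp 2 k : Lp ℂ 2 torusMeasure),
    UnitAddTorus.coeFn_mFourierLp (d := Fin 2) 2 k] with x hx hx'
  rw [hx, Pi.smul_apply, hx', smul_eq_mul]

theorem integral_mFourier_mul_fourierSum {c : Freq → ℂ} (h : Memℓp c 2) (k : Freq) :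
    ∫ x, conj (UnitAddTorus.mFourier k x) * fourierSum c x ∂torusMeasure = c k := by
  have h1 := UnitAddTorus.mFourierBasis_repr (ellTwoEquiv (⟨c, h⟩ : EllTwo)) k
  have h2 : UnitAddTorus.mFourierBasis.repr (ellTwoEquiv (⟨c, h⟩ : EllTwo)) = ⟨c, h⟩ :=
    UnitAddTorus.mFourierBasis.repr.apply_symm_apply _
  rw [h2] at h1
  rw [fourierSum_of_memℓp h]
  simp_rw [← UnitAddTorus.mFourier_neg]
  exact h1.symm

theorem integral_conj_fourierSum_mul_fourierSum {a b : Freq → ℂ} (ha : Memℓp a 2)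
    (hb : Memℓp b 2) :
    HasSum (fun k => b k * conj (a k))
      (∫ x, fourierSum b x * conj (fourierSum a x) ∂torusMeasure) := by
  have h1 := lp.hasSum_inner (𝕜 := ℂ) (⟨a, ha⟩ : EllTwo) ⟨b, hb⟩
  rw [← ellTwoEquiv.inner_map_map, L2.inner_def] at h1
  rw [fourierSum_of_memℓp ha, fourierSum_of_memℓp hb]
  exact h1

/-- Square summable Fourier coefficients of a real function. -/
structure IsRealEllTwo (c : Freq → ℂ) : Prop where
  memℓp : Memℓp c 2
  apply_neg : ∀ k, c (-k) = conj (c k)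

theorem ae_eq_of_mFourier_integral_eq {f g : Torus → ℂ} (hf : MemLp f 2 torusMeasure)
    (hg : MemLp g 2 torusMeasure)
    (h : ∀ k, ∫ x, conj (UnitAddTorus.mFourier k x) * f x ∂torusMeasure =
      ∫ x, conj (UnitAddTorus.mFourier k x) * g x ∂torusMeasure) :
    f =ᵐ[torusMeasure] g := by
  have key : ∀ {u : Torus → ℂ} (hu : MemLp u 2 torusMeasure) (k : Freq),
      (ellTwoEquiv.symm (hu.toLp u) : EllTwo) k =
        ∫ x, conj (UnitAddTorus.mFourier k x) * u x ∂torusMeasure := by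
    intro u hu k
    refine (UnitAddTorus.mFourierBasis_repr (hu.toLp u) k).trans ?_
    refine integral_congr_ae ?_
    filter_upwards [hu.coeFn_toLp] with x hx
    rw [UnitAddTorus.mFourier_neg, smul_eq_mul, hx]
  have h2 : ellTwoEquiv.symm (hf.toLp f) = ellTwoEquiv.symm (hg.toLp g) := by
    ext k
    rw [key hf k, key hg k, h k]
  exact (MemLp.toLp_eq_toLp_iff hf hg).1 (ellTwoEquiv.symm.injective h2)

/-- The symmetry `c_{-k} = conj c_k` says that the sum and its complex conjugate have the same
Fourier coefficients. -/
theorem IsRealEllTwo.fourierSum_ae_eq {c : Freq → ℂ} (hc : IsRealEllTwo c) :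
    ∀ᵐ x ∂torusMeasure, fourierSum c x = (realize c x : ℂ) := by
  have hconj : MemLp (fun x => conj (fourierSum c x)) 2 torusMeasure :=
    (memLp_fourierSum c).star
  have h : fourierSum c =ᵐ[torusMeasure] fun x => conj (fourierSum c x) := by
    refine ae_eq_of_mFourier_integral_eq (memLp_fourierSum c) hconj fun k => ?_
    rw [integral_mFourier_mul_fourierSum hc.memℓp]
    have h1 := integral_mFourier_mul_fourierSum hc.memℓp (-k)
    rw [hc.apply_neg] at h1
    have h2 := congrArg conj h1
    rw [Complex.conj_conj, ← integral_conj] at h2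
    rw [← h2]
    refine integral_congr_ae (.of_forall fun x => ?_)
    simp [UnitAddTorus.mFourier_neg]
  filter_upwards [h] with x hx
  exact (Complex.conj_eq_iff_re.1 hx.symm).symm

theorem IsRealEllTwo.eq_of_realize_ae_eq {a b : Freq → ℂ} (ha : IsRealEllTwo a)
    (hb : IsRealEllTwo b) (h : realize a =ᵐ[torusMeasure] realize b) : a = b := by
  ext k
  rw [← integral_mFourier_mul_fourierSum ha.memℓp, ← integral_mFourier_mul_fourierSum hb.memℓp]
  refine integral_congr_ae ?_
  filter_upwards [ha.fourierSum_ae_eq, hb.fourierSum_ae_eq, h] with x h1 h2 h3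
  rw [h1, h2, h3]

theorem integrable_realize_mul_realize (a b : Freq → ℂ) :
    Integrable (fun x => realize a x * realize b x) torusMeasure :=
  (memLp_realize a).integrable_mul (memLp_realize b)

theorem IsRealEllTwo.hasSum_integral_mul {a b : Freq → ℂ} (ha : IsRealEllTwo a)
    (hb : IsRealEllTwo b) :
    HasSum (fun k => a k * conj (b k))
      ((∫ x, realize a x * realize b x ∂torusMeasure : ℝ) : ℂ) := by
  convert! integral_conj_fourierSum_mul_fourierSum hb.memℓp ha.memℓp using 1
  rw [← integral_complex_ofReal]
  refine integral_congr_ae ?_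
  filter_upwards [ha.fourierSum_ae_eq, hb.fourierSum_ae_eq] with x h1 h2
  rw [h1, h2]
  simp

/-! ### Uniqueness of Fourier coefficients in `L¹` -/

/-- An integrable function on the torus with vanishing Fourier coefficients vanishes. -/
theorem ae_eq_zero_of_forall_integral_mFourier {h : Torus → ℝ} (hh : Integrable h torusMeasure)
    (hk : ∀ k : Freq, ∫ x, UnitAddTorus.mFourier k x * (h x : ℂ) ∂torusMeasure = 0) :
    h =ᵐ[torusMeasure] 0 := by
  have hint : ∀ f : C(Torus, ℂ), Integrable (fun x => f x * (h x : ℂ)) torusMeasure := fun f =>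
    hh.ofReal.bdd_mul f.continuous.aestronglyMeasurable
      (Filter.Eventually.of_forall fun x => f.norm_coe_le_norm x)
  let Λ : C(Torus, ℂ) →ₗ[ℂ] ℂ :=
    { toFun := fun f => ∫ x, f x * (h x : ℂ) ∂torusMeasure
      map_add' := fun f g => by
        simp only [ContinuousMap.add_apply, add_mul]
        exact integral_add (hint f) (hint g)
      map_smul' := fun r f => by
        simp only [ContinuousMap.smul_apply, smul_eq_mul, mul_assoc, RingHom.id_apply]
        exact integral_const_mul _ _ }
  let Λ' : C(Torus, ℂ) →L[ℂ] ℂ := Λ.mkContinuous (∫ x, ‖h x‖ ∂torusMeasure) fun f => by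
    refine (norm_integral_le_of_norm_le (hh.norm.const_mul ‖f‖)
      (Filter.Eventually.of_forall fun x => ?_)).trans ?_
    · rw [norm_mul, Complex.norm_real]
      gcongr
      exact f.norm_coe_le_norm x
    · rw [integral_const_mul, mul_comm]
  have hΛ : ∀ f : C(Torus, ℂ), ∫ x, f x * (h x : ℂ) ∂torusMeasure = 0 := by
    -- The functional is bounded on `C(𝕋²)` by the `L¹` norm of `h`, so its kernel is closed; it
    -- contains the dense span of the characters.
    have h1 : Submodule.span ℂ (range (UnitAddTorus.mFourier (d := Fin 2))) ≤ Λ'.ker := by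
      rw [Submodule.span_le]
      rintro _ ⟨k, rfl⟩
      exact hk k
    have h2 := Submodule.topologicalClosure_minimal _ h1 Λ'.isClosed_ker
    rw [UnitAddTorus.span_mFourier_closure_eq_top] at h2
    exact fun f => h2 (Submodule.mem_top (x := f))
  refine ae_eq_zero_of_forall_setIntegral_isClosed_eq_zero hh fun s hs => ?_
  -- Indicators of closed sets are bounded pointwise limits of continuous functions, which passes
  -- the vanishing on to set integrals.
  have hlim : Filter.Tendsto (fun n => ∫ x, ((hs.apprSeq n x : NNReal) : ℝ) * h x ∂torusMeasure)
      Filter.atTop (nhds (∫ x, s.indicator h x ∂torusMeasure)) := by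
    refine tendsto_integral_of_dominated_convergence (fun x => ‖h x‖) (fun n => ?_) hh.norm
      (fun n => .of_forall fun x => ?_) (.of_forall fun x => ?_)
    · exact (NNReal.continuous_coe.comp (hs.apprSeq n).continuous).aestronglyMeasurable.mul
        hh.aestronglyMeasurable
    · rw [norm_mul]
      refine mul_le_of_le_one_left (norm_nonneg _) ?_
      simpa using HasOuterApproxClosed.apprSeq_apply_le_one hs n x
    · have h1 := (tendsto_pi_nhds.1 (HasOuterApproxClosed.tendsto_apprSeq hs)) x
      have h2 := ((NNReal.tendsto_coe.2 h1).mul_const (h x))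
      convert! h2 using 2
      by_cases hx : x ∈ s <;> simp [hx]
  have hzero : ∀ n, ∫ x, ((hs.apprSeq n x : NNReal) : ℝ) * h x ∂torusMeasure = 0 := by
    intro n
    have h1 := hΛ ⟨fun x => (((hs.apprSeq n x : NNReal) : ℝ) : ℂ),
      Complex.continuous_ofReal.comp (NNReal.continuous_coe.comp (hs.apprSeq n).continuous)⟩
    simp only [ContinuousMap.coe_mk, ← Complex.ofReal_mul] at h1
    rw [integral_complex_ofReal] at h1
    exact_mod_cast h1
  simp_rw [hzero] at hlim
  rw [← integral_indicator hs.measurableSet]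
  exact (tendsto_nhds_unique hlim tendsto_const_nhds)

/-! ### Sobolev bounds and continuity of coefficients and derivatives -/

theorem one_le_freqNorm {k : Freq} (hk : k ≠ 0) : 1 ≤ freqNorm k := by
  have h0 := freqNorm_pos hk
  unfold freqNorm at *
  rw [Real.sqrt_pos] at h0
  rw [Real.one_le_sqrt]
  have h1 : 0 < k 0 ^ 2 + k 1 ^ 2 := by exact_mod_cast h0
  exact_mod_cast h1

theorem freqNorm_neg (k : Freq) : freqNorm (-k) = freqNorm k := by
  simp [freqNorm]

theorem abs_apply_le_freqNorm (k : Freq) (j : Fin 2) : |(k j : ℝ)| ≤ freqNorm k := by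
  unfold freqNorm
  apply Real.abs_le_sqrt
  fin_cases j
  · simp [sq_nonneg]
  · simp [sq_nonneg]

theorem norm_weighted (s : ℝ) (c : Freq → ℂ) (k : Freq) :
    ‖weighted s c k‖ = freqNorm k ^ s * ‖c k‖ := by
  have : 0 ≤ freqNorm k ^ s := Real.rpow_nonneg (Real.sqrt_nonneg _) s
  rw [weighted, norm_mul, Complex.norm_real, Real.norm_of_nonneg this]

theorem norm_le_norm_weighted {s : ℝ} (hs : 0 ≤ s) {c : Freq → ℂ} (hc : c 0 = 0) (k : Freq) :
    ‖c k‖ ≤ ‖weighted s c k‖ := by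
  by_cases hk : k = 0
  · simp [hk, hc]
  rw [norm_weighted]
  exact le_mul_of_one_le_left (norm_nonneg _) (Real.one_le_rpow (one_le_freqNorm hk) hs)

theorem norm_derivCoeff_le {s : ℝ} (hs : 1 ≤ s) (c : Freq → ℂ) (j : Fin 2) (k : Freq) :
    ‖derivCoeff c j k‖ ≤ ‖((2 * Real.pi : ℝ) • weighted s c) k‖ := by
  rw [Pi.smul_apply, norm_smul, norm_weighted, derivCoeff]
  simp only [norm_mul, Complex.norm_real, Complex.norm_I, mul_one, Complex.norm_intCast,
    Complex.norm_ofNat, Real.norm_eq_abs, abs_two]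
  rw [← mul_assoc (2 * |Real.pi|)]
  gcongr
  by_cases hk : k = 0
  · have : 0 ≤ freqNorm k ^ s := Real.rpow_nonneg (Real.sqrt_nonneg _) s
    simpa [hk] using this
  calc _ ≤ freqNorm k := abs_apply_le_freqNorm k j
    _ = freqNorm k ^ (1 : ℝ) := (Real.rpow_one _).symm
    _ ≤ freqNorm k ^ s := Real.rpow_le_rpow_of_exponent_le (one_le_freqNorm hk) hs

namespace Hs

variable {s : ℝ}

theorem isRealEllTwo_coeff (hs : 0 ≤ s) (u : Hs s) : IsRealEllTwo u.coeff where
  memℓp := u.2.2.2.mono' (norm_le_norm_weighted hs u.2.1)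
  apply_neg := u.2.2.1

theorem isRealEllTwo_derivCoeff (hs : 1 ≤ s) (u : Hs s) (j : Fin 2) :
    IsRealEllTwo (derivCoeff u.coeff j) where
  memℓp := by
    have h : Memℓp ((2 * Real.pi : ℝ) • weighted s u.coeff) 2 := u.2.2.2.const_smul _
    exact h.mono' (norm_derivCoeff_le hs u.coeff j)
  apply_neg k := by
    have : u.coeff (-k) = conj (u.coeff k) := u.2.2.1 k
    simp [derivCoeff, this, Complex.conj_ofReal, Complex.conj_ofNat]

/-- The Fourier coefficients of `∂_j u`, as a continuous additive map from `H^s`, `1 ≤ s`. -/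
def derivHom (hs : 1 ≤ s) (j : Fin 2) : Hs s →+ EllTwo where
  toFun u := ⟨derivCoeff u.coeff j, (u.isRealEllTwo_derivCoeff hs j).memℓp⟩
  map_zero' := by
    ext k
    change derivCoeff (0 : Freq → ℂ) j k = 0
    simp [derivCoeff]
  map_add' u v := by
    ext k
    change derivCoeff (u.coeff + v.coeff) j k = derivCoeff u.coeff j k + derivCoeff v.coeff j k
    simp [derivCoeff, mul_add]

theorem continuous_derivHom (hs : 1 ≤ s) (j : Fin 2) : Continuous (derivHom hs j) := by
  refine AddMonoidHomClass.continuous_of_bound _ (2 * Real.pi) fun u => ?_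
  have h := lp.norm_mono (p := 2) two_ne_zero (x := derivHom hs j u)
    (y := (2 * Real.pi : ℝ) • toEllTwo s u) (norm_derivCoeff_le hs u.coeff j)
  rwa [norm_smul, Real.norm_of_nonneg (by positivity)] at h

theorem norm_coeff_le {k : Freq} (hk : k ≠ 0) (u : Hs s) :
    ‖u.coeff k‖ ≤ (freqNorm k ^ s)⁻¹ * ‖u‖ := by
  have hc : 0 < freqNorm k ^ s := Real.rpow_pos_of_pos (freqNorm_pos hk) s
  have h : ‖weighted s u.coeff k‖ ≤ ‖u‖ :=
    lp.norm_apply_le_norm two_ne_zero (toEllTwo s u) k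
  rw [norm_weighted] at h
  rwa [inv_mul_eq_div, le_div_iff₀' hc]

theorem continuous_coeff (k : Freq) : Continuous fun u : Hs s => u.coeff k := by
  by_cases hk : k = 0
  · have : (fun u : Hs s => u.coeff k) = fun _ => 0 := by
      ext u
      rw [hk]
      exact u.2.1
    rw [this]
    exact continuous_const
  · exact AddMonoidHomClass.continuous_of_bound
      (⟨⟨fun u => u.coeff k, rfl⟩, fun u v => rfl⟩ : Hs s →+ ℂ) (freqNorm k ^ s)⁻¹
      (norm_coeff_le hk)

/-- For `a ∈ L²`, the integral `∫ a ∂_j u` depends continuously on `u ∈ H^s`, `1 ≤ s`. -/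
theorem continuous_integral_mul_deriv (hs : 1 ≤ s) (j : Fin 2) {a : Torus → ℝ}
    (ha : MemLp a 2 torusMeasure) :
    Continuous fun u : Hs s => ∫ x, a x * realize (derivCoeff u.coeff j) x ∂torusMeasure := by
  have ha' : MemLp (fun x => (a x : ℂ)) 2 torusMeasure := ha.ofReal
  -- The integral is the real part of an inner product with a fixed vector, composed with the
  -- continuous map `derivHom`.
  have h : Continuous fun u : Hs s =>
      (inner ℂ (ha'.toLp _) (ellTwoEquiv (derivHom hs j u))).re :=
    Complex.continuous_re.comp
      (continuous_const.inner (ellTwoEquiv.continuous.comp (continuous_derivHom hs j)))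
  convert! h using 2 with u
  have hu := u.isRealEllTwo_derivCoeff hs j
  rw [L2.inner_def, ← Complex.ofReal_re (∫ x, a x * realize (derivCoeff u.coeff j) x ∂torusMeasure),
    ← integral_complex_ofReal]
  congr 1
  refine integral_congr_ae ?_
  filter_upwards [ha'.coeFn_toLp, hu.fourierSum_ae_eq] with x h1 h2
  rw [fourierSum_of_memℓp hu.memℓp] at h2
  change _ = inner ℂ _ ((ellTwoEquiv ⟨derivCoeff u.coeff j, hu.memℓp⟩ : Lp ℂ 2 torusMeasure) x)
  rw [h1, h2]
  simp [mul_comm]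

end Hs

/-! ### Trigonometric test functions -/

/-- The real trigonometric function `2 Re (α e^{2πi 𝐤·𝐱})`, `𝐤 ≠ 0`, as an element of `H^s`. -/
def trigMode (s : ℝ) {k : Freq} (hk : k ≠ 0) (α : ℂ) : Hs s :=
  ⟨Pi.single k α + Pi.single (-k) (conj α), by
    refine ⟨?_, fun l => ?_, ?_⟩
    · simp [hk.symm, (neg_ne_zero.2 hk).symm]
    · have h1 : -l = k ↔ l = -k := neg_eq_iff_eq_neg
      simp only [Pi.add_apply, Pi.single_apply, map_add, neg_inj, h1]
      split_ifs <;> simp [add_comm]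
    · have h : weighted s (Pi.single k α + Pi.single (-k) (conj α)) =
          Pi.single k (((freqNorm k ^ s : ℝ) : ℂ) * α) +
            Pi.single (-k) (((freqNorm (-k) ^ s : ℝ) : ℂ) * conj α) := by
        ext l
        simp only [weighted, Pi.add_apply, Pi.single_apply, mul_add]
        split_ifs with h1 h2 <;> simp_all
      rw [h]
      exact (memℓp_single k _).add (memℓp_single (-k) _)⟩

theorem coeff_trigMode (s : ℝ) {k : Freq} (hk : k ≠ 0) (α : ℂ) :
    (trigMode s hk α).coeff = Pi.single k α + Pi.single (-k) (conj α) := rfl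

theorem realize_trigMode (s : ℝ) {k : Freq} (hk : k ≠ 0) (α : ℂ) :
    ∀ᵐ x ∂torusMeasure, realize (trigMode s hk α).coeff x =
      2 * (α * UnitAddTorus.mFourier k x).re := by
  filter_upwards [fourierSum_add (memℓp_single k α) (memℓp_single (-k) (conj α)),
    fourierSum_single k α, fourierSum_single (-k) (conj α)] with x h1 h2 h3
  rw [coeff_trigMode, realize, h1, Pi.add_apply, h2, h3, UnitAddTorus.mFourier_neg, ← map_mul,
    Complex.add_re, Complex.conj_re]
  ring

/-! ### Divergence-free flows -/

namespace Flow

variable {m : ℝ} (v : Flow m)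

/-- The multiplier `k^⊥_j / ‖k‖` is at most one in modulus and odd in `k`; its sign cancels the one
in `conj v_k = -v_{-k}`. -/
theorem isRealEllTwo_fieldCoeff (hm : 0 ≤ m) (j : Fin 2) : IsRealEllTwo (v.fieldCoeff j) where
  memℓp := by
    refine v.memℓp.mono' fun k => le_trans ?_ (norm_le_norm_weighted hm v.coeff_zero k)
    rw [fieldCoeff, norm_mul]
    refine mul_le_of_le_one_right (norm_nonneg _) ?_
    rw [norm_div, Complex.norm_real, Complex.norm_intCast,
      Real.norm_of_nonneg (show 0 ≤ freqNorm k from Real.sqrt_nonneg _)]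
    refine div_le_one_of_le₀ ?_ (Real.sqrt_nonneg _)
    fin_cases j
    · simpa [perp] using abs_apply_le_freqNorm k 1
    · simpa [perp] using abs_apply_le_freqNorm k 0
  apply_neg k := by
    have h : perp (-k) j = -perp k j := by fin_cases j <;> simp [perp]
    rw [fieldCoeff, fieldCoeff, h, freqNorm_neg, map_mul, v.conj_coeff]
    simp [Complex.conj_ofReal]
    ring

/-- A divergence-free flow is orthogonal to every gradient. -/
theorem sum_integral_field_mul_deriv {s : ℝ} (hm : 0 ≤ m) (hs : 1 ≤ s) (u : Hs s) :
    ∑ j, ∫ x, realize (v.fieldCoeff j) x * realize (derivCoeff u.coeff j) x ∂torusMeasure = 0 := by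
  have h := hasSum_sum (s := Finset.univ) fun (j : Fin 2) _ =>
    (v.isRealEllTwo_fieldCoeff hm j).hasSum_integral_mul (u.isRealEllTwo_derivCoeff hs j)
  -- By Parseval the sum is taken mode by mode, and each term contains `k^⊥ · k = 0`.
  have h0 : (fun k => ∑ j, v.fieldCoeff j k * conj (derivCoeff u.coeff j k)) = 0 := by
    ext k
    simp [Fin.sum_univ_two, fieldCoeff, derivCoeff, perp]
    ring
  rw [h0] at h
  exact_mod_cast h.unique hasSum_zero

/-- For `k ≠ 0` some component of `k^⊥` is nonzero, and that component of the field determines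
`v_k`. -/
theorem eq_of_field_ae_eq (hm : 0 ≤ m) {v v' : Flow m}
    (h : ∀ᵐ x ∂torusMeasure, v.field x = v'.field x) : v = v' := by
  have hj : ∀ j, v.fieldCoeff j = v'.fieldCoeff j := fun j =>
    (v.isRealEllTwo_fieldCoeff hm j).eq_of_realize_ae_eq (v'.isRealEllTwo_fieldCoeff hm j)
      (h.mono fun x hx => congrFun hx j)
  ext k
  by_cases hk : k = 0
  · rw [hk, v.coeff_zero, v'.coeff_zero]
  have hn : (freqNorm k : ℂ) ≠ 0 := Complex.ofReal_ne_zero.2 (freqNorm_pos hk).ne'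
  have h0 := congrFun (hj 0) k
  have h1 := congrFun (hj 1) k
  simp only [fieldCoeff, perp, Matrix.cons_val_zero, Matrix.cons_val_one] at h0 h1
  by_cases hk0 : k 0 = 0
  · have hk1 : k 1 ≠ 0 := fun hk1 => hk (by ext j; fin_cases j <;> simp [hk0, hk1])
    refine mul_right_cancel₀ (div_ne_zero ?_ hn) h0
    exact_mod_cast neg_ne_zero.2 hk1
  · refine mul_right_cancel₀ (div_ne_zero ?_ hn) h1
    exact_mod_cast hk0

end Flow

/-! ### Weak time derivatives -/

theorem MemL2Loc.integrableOn_coeff {r : ℝ} {g : ℝ → Hs r} (hg : MemL2Loc g) (R : ℝ) (k : Freq) :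
    IntegrableOn (fun t => (g t).coeff k) (Icc 0 R) := by
  by_cases hk : k = 0
  · have : (fun t => (g t).coeff k) = fun _ => 0 := funext fun t => hk ▸ (g t).2.1
    rw [this]
    exact integrableOn_zero
  · refine ((hg R).integrable one_le_two).norm.const_mul (freqNorm k ^ r)⁻¹ |>.mono'
      ((Hs.continuous_coeff k).comp_aestronglyMeasurable (hg R).1) (.of_forall fun t => ?_)
    exact Hs.norm_coeff_le hk (g t)

/-- Weak time derivatives are determined on `(0,T)` by the values of the function on `[0,T]`. -/
theorem IsWeakTimeDeriv.ae_coeff_eq {s r T : ℝ} {θ θ' : ℝ → Hs s} {g g' : ℝ → Hs r}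
    (h : IsWeakTimeDeriv θ g) (h' : IsWeakTimeDeriv θ' g') (hg : MemL2Loc g) (hg' : MemL2Loc g')
    (hθ : EqOn θ θ' (Icc 0 T)) :
    ∀ᵐ t ∂volume, t ∈ Ioo 0 T → (g t).coeff = (g' t).coeff := by
  -- Work one mode at a time: there are countably many, so the exceptional null sets can be merged
  -- at the end.
  have key : ∀ k : Freq, ∀ᵐ t ∂volume, t ∈ Ioo 0 T → (g t).coeff k - (g' t).coeff k = 0 := by
    intro k
    have hint := (hg.integrableOn_coeff T k).mono_set (Ioo_subset_Icc_self (a := 0) (b := T))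
    have hint' := (hg'.integrableOn_coeff T k).mono_set (Ioo_subset_Icc_self (a := 0) (b := T))
    refine isOpen_Ioo.ae_eq_zero_of_integral_contDiff_smul_eq_zero
      (hint.sub hint').locallyIntegrableOn fun η hη hc hs => ?_
    have hη0 : ∀ t ∉ Ioo 0 T, η t = 0 := fun t ht => image_eq_zero_of_notMem_tsupport
      fun h => ht (hs h)
    have hη0' : ∀ t ∉ Ioo 0 T, deriv η t = 0 := fun t ht =>
      image_eq_zero_of_notMem_tsupport fun h => ht (hs (tsupport_deriv_subset h))
    have hIoi : ∀ F : ℝ → ℂ, ∫ t in Ioi (0 : ℝ), ((η t : ℝ) : ℂ) * F t =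
        ∫ t in Ioo 0 T, ((η t : ℝ) : ℂ) * F t := fun F =>
      setIntegral_eq_of_subset_of_forall_sdiff_eq_zero measurableSet_Ioi Ioo_subset_Ioi_self
        fun t ht => by simp [hη0 t ht.2]
    have hmul : ∀ {F : ℝ → ℂ}, IntegrableOn F (Ioo 0 T) →
        IntegrableOn (fun t => ((η t : ℝ) : ℂ) * F t) (Ioo 0 T) := fun hF => by
      obtain ⟨C, hC⟩ := hη.continuous.bounded_above_of_compact_support hc
      refine hF.bdd_mul (c := C)
        (Complex.continuous_ofReal.comp hη.continuous).aestronglyMeasurable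
        (.of_forall fun t => ?_)
      rw [Complex.norm_real]
      exact hC t
    have hleft : ∫ t in Ioi (0 : ℝ), ((deriv η t : ℝ) : ℂ) * (θ t).coeff k =
        ∫ t in Ioi (0 : ℝ), ((deriv η t : ℝ) : ℂ) * (θ' t).coeff k := by
      refine setIntegral_congr_fun measurableSet_Ioi fun t _ => ?_
      by_cases ht : t ∈ Ioo 0 T
      · simp only [hθ (Ioo_subset_Icc_self ht)]
      · simp [hη0' t ht]
    have hsub : tsupport η ⊆ Ioi 0 := hs.trans Ioo_subset_Ioi_self
    rw [h η hη hc hsub k, h' η hη hc hsub k, neg_inj, hIoi, hIoi] at hleft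
    rw [← setIntegral_eq_integral_of_forall_compl_eq_zero (s := Ioo 0 T)
      fun t ht => by simp [hη0 t ht]]
    simp only [Complex.real_smul, mul_sub]
    rw [integral_sub (hmul hint) (hmul hint'), hleft, sub_self]
  filter_upwards [ae_all_iff.2 key] with t ht hT
  exact funext fun k => sub_eq_zero.1 (ht k hT)

/-! ### The advection term at the initial time -/

theorem memLp_realize_mul_trig (a : Freq → ℂ) (k : Freq) (α : ℂ) :
    MemLp (fun x => realize a x * (2 * (α * UnitAddTorus.mFourier k x).re)) 2 torusMeasure := by
  have hq : Continuous fun x => 2 * (α * UnitAddTorus.mFourier k x).re := by fun_prop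
  obtain ⟨C, hC⟩ := (isCompact_range hq).isBounded.exists_norm_le
  have hq' : MemLp (fun x => 2 * (α * UnitAddTorus.mFourier k x).re) ∞ torusMeasure :=
    memLp_top_of_bound hq.aestronglyMeasurable C (.of_forall fun x => hC _ (mem_range_self x))
  exact hq'.mul (memLp_realize a)

theorem Flow.integral_field_dotProduct_grad_mul_trigMode {m s : ℝ} (v : Flow m)
    (u : Hs s) {k : Freq} (hk : k ≠ 0) (α : ℂ) :
    ∫ x, (v.field x ⬝ᵥ grad u.coeff x) * realize (trigMode 1 hk α).coeff x ∂torusMeasure =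
      ∑ j, ∫ x, realize (v.fieldCoeff j) x * (2 * (α * UnitAddTorus.mFourier k x).re) *
        realize (derivCoeff u.coeff j) x ∂torusMeasure := by
  have hi : ∀ j ∈ Finset.univ, Integrable (fun x => realize (v.fieldCoeff j) x *
      (2 * (α * UnitAddTorus.mFourier k x).re) * realize (derivCoeff u.coeff j) x) torusMeasure :=
    fun j _ => (memLp_realize_mul_trig (v.fieldCoeff j) k α).integrable_mul (memLp_realize _)
  rw [← integral_finsetSum _ hi]
  refine integral_congr_ae ?_
  filter_upwards [realize_trigMode 1 hk α] with x hx
  rw [hx]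
  simp only [dotProduct, field, grad, Finset.sum_mul]
  exact Finset.sum_congr rfl fun j _ => by ring

/-- Flows which transport a solution in the same way act equally on the initial gradient. -/
theorem ae_field_dotProduct_grad_eq {κ m s T : ℝ} (hm : 0 ≤ m) (hs : 1 ≤ s) (hT : 0 < T)
    {v v' : Flow m} {θ₀ : Hs s} {θ θ' : ℝ → Hs s} (h : IsSolution κ v θ₀ θ)
    (h' : IsSolution κ v' θ₀ θ') (hθ : EqOn θ θ' (Icc 0 T)) :
    ∀ᵐ x ∂torusMeasure, (v.field x - v'.field x) ⬝ᵥ grad θ₀.coeff x = 0 := by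
  obtain ⟨g, hg, hgθ, hweak⟩ := h.weak_eq
  obtain ⟨g', hg', hgθ', hweak'⟩ := h'.weak_eq
  let q : Freq → ℂ → Torus → ℝ := fun k α x => 2 * (α * UnitAddTorus.mFourier k x).re
  let J : Flow m → Freq → ℂ → Hs s → ℝ := fun v k α u =>
    ∑ j, ∫ x, realize (v.fieldCoeff j) x * q k α x * realize (derivCoeff u.coeff j) x ∂torusMeasure
  have hJ : ∀ v k α, Continuous (J v k α) := fun v k α =>
    continuous_finsetSum _ fun j _ =>
      Hs.continuous_integral_mul_deriv hs j (memLp_realize_mul_trig (v.fieldCoeff j) k α)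
  have hJ0 : ∀ k, k ≠ 0 → ∀ α, J v k α θ₀ = J v' k α θ₀ := by
    intro k hk α
    have hae : (fun t => J v k α (θ t)) =ᵐ[volume.restrict (Icc 0 T)]
        fun t => J v' k α (θ t) := by
      rw [restrict_Ioo_eq_restrict_Icc.symm]
      have hsub : Ioo 0 T ⊆ Ici (0 : ℝ) := fun t ht => ht.1.le
      filter_upwards [ae_restrict_of_ae_restrict_of_subset hsub (hweak (trigMode 1 hk α)),
        ae_restrict_of_ae_restrict_of_subset hsub (hweak' (trigMode 1 hk α)),
        (ae_restrict_iff' measurableSet_Ioo).2 (hgθ.ae_coeff_eq hgθ' hg hg' hθ),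
        ae_restrict_mem measurableSet_Ioo] with t h1 h2 h3 h4
      -- Once `θ' t` and `g' t` are replaced by `θ t` and `g t`, the time derivative and diffusion
      -- terms of both equations are identical and cancel.
      rw [v.integral_field_dotProduct_grad_mul_trigMode] at h1
      rw [v'.integral_field_dotProduct_grad_mul_trigMode, ← hθ (Ioo_subset_Icc_self h4),
        ← h3] at h2
      change _ + J v k α (θ t) + _ = 0 at h1
      change _ + J v' k α (θ t) + _ = 0 at h2
      linarith
    have hc : ContinuousOn θ (Icc 0 T) := h.continuousOn.mono Icc_subset_Ici_self
    -- Continuous functions equal almost everywhere on `[0,T]` are equal at the endpoint `0` too; `0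
    -- < T` enters here.
    have := Measure.eqOn_Icc_of_ae_eq volume hT.ne hae ((hJ v k α).comp_continuousOn hc)
      ((hJ v' k α).comp_continuousOn hc) (left_mem_Icc.2 hT.le)
    simpa only [h.initial] using this
  have hadv : ∀ v : Flow m, Integrable (fun x => v.field x ⬝ᵥ grad θ₀.coeff x) torusMeasure :=
    fun v => integrable_finsetSum _ fun j _ => integrable_realize_mul_realize _ _
  have hint : Integrable (fun x => (v.field x - v'.field x) ⬝ᵥ grad θ₀.coeff x) torusMeasure := by
    simp only [sub_dotProduct]
    exact (hadv v).sub (hadv v')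
  have hcpx : ∀ k : Freq, Integrable (fun x => UnitAddTorus.mFourier k x *
      (((v.field x - v'.field x) ⬝ᵥ grad θ₀.coeff x : ℝ) : ℂ)) torusMeasure := fun k =>
    hint.ofReal.bdd_mul (UnitAddTorus.mFourier k).continuous.aestronglyMeasurable
      (.of_forall fun x => (UnitAddTorus.mFourier k).norm_coe_le_norm x)
  have hre : ∀ k, k ≠ 0 → ∀ α : ℂ, (α * ∫ x, UnitAddTorus.mFourier k x *
      (((v.field x - v'.field x) ⬝ᵥ grad θ₀.coeff x : ℝ) : ℂ) ∂torusMeasure).re = 0 := by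
    intro k hk α
    have h1 := hJ0 k hk α
    have h2 : ∀ v : Flow m, J v k α θ₀ =
        ∫ x, (v.field x ⬝ᵥ grad θ₀.coeff x) * q k α x ∂torusMeasure ∧
        Integrable (fun x => (v.field x ⬝ᵥ grad θ₀.coeff x) * q k α x) torusMeasure := by
      intro v
      have hi : ∀ j ∈ Finset.univ, Integrable (fun x => realize (v.fieldCoeff j) x * q k α x *
          realize (derivCoeff θ₀.coeff j) x) torusMeasure := fun j _ =>
        (memLp_realize_mul_trig (v.fieldCoeff j) k α).integrable_mul (memLp_realize _)
      have he : (fun x => (v.field x ⬝ᵥ grad θ₀.coeff x) * q k α x) = fun x =>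
          ∑ j, realize (v.fieldCoeff j) x * q k α x * realize (derivCoeff θ₀.coeff j) x := by
        ext x
        simp only [dotProduct, Flow.field, grad, Finset.sum_mul]
        exact Finset.sum_congr rfl fun j _ => by ring
      rw [he]
      exact ⟨(integral_finsetSum _ hi).symm, integrable_finsetSum _ hi⟩
    rw [(h2 v).1, (h2 v').1, ← sub_eq_zero, ← integral_sub (h2 v).2 (h2 v').2] at h1
    rw [← integral_const_mul]
    have h3 := integral_re ((hcpx k).const_mul α)
    refine h3.symm.trans ?_
    refine (mul_eq_zero.1 ?_).resolve_left (two_ne_zero (α := ℝ))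
    rw [← integral_const_mul, ← h1]
    refine integral_congr_ae (.of_forall fun x => ?_)
    simp only [q, RCLike.re_eq_complex_re, ← mul_assoc α, Complex.re_mul_ofReal, sub_dotProduct]
    ring
  refine ae_eq_zero_of_forall_integral_mFourier hint fun k => ?_
  -- The constant mode is not an admissible test function, as `Hs 1` is mean-free; there
  -- orthogonality of flows to gradients is used instead.
  by_cases hk : k = 0
  · have h1 : ∀ v : Flow m, ∫ x, v.field x ⬝ᵥ grad θ₀.coeff x ∂torusMeasure = 0 := fun v =>
      (integral_finsetSum _ fun j _ => integrable_realize_mul_realize _ _).trans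
        (v.sum_integral_field_mul_deriv hm hs θ₀)
    simp only [hk, UnitAddTorus.mFourier_zero, ContinuousMap.one_apply, one_mul]
    rw [integral_complex_ofReal]
    simp only [sub_dotProduct]
    rw [integral_sub (hadv v) (hadv v'), h1, h1, sub_zero, Complex.ofReal_zero]
  · have h1 := hre k hk 1
    -- `α = 1` gives the real part of the Fourier coefficient and `α = -i` the imaginary part.
    have h2 := hre k hk (-Complex.I)
    apply Complex.ext
    · simpa using h1
    · simpa using h2

/-! ### From the pair of solutions to the flow -/

/-- At almost every time equality in space forces equal Fourier coefficients, and continuity into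
`H^s` removes the exceptional times. -/
theorem IsSolutionL2.exists_eqOn {κ T m s : ℝ} (hs : 0 ≤ s) (hT : 0 < T) {θ₀ : Hs s}
    {v v' : Flow m} {Θ : SpaceTimeL2 T} (h : IsSolutionL2 κ T θ₀ v Θ)
    (h' : IsSolutionL2 κ T θ₀ v' Θ) :
    ∃ θ θ' : ℝ → Hs s, IsSolution κ v θ₀ θ ∧ IsSolution κ v' θ₀ θ' ∧ EqOn θ θ' (Icc 0 T) := by
  obtain ⟨θ, hθ, hΘ⟩ := h
  obtain ⟨θ', hθ', hΘ'⟩ := h'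
  refine ⟨θ, θ', hθ, hθ', Measure.eqOn_Icc_of_ae_eq volume hT.ne ?_
    (hθ.continuousOn.mono Icc_subset_Ici_self) (hθ'.continuousOn.mono Icc_subset_Ici_self)⟩
  filter_upwards [hΘ, hΘ'] with t h1 h2
  refine Subtype.ext ((Hs.isRealEllTwo_coeff hs (θ t)).eq_of_realize_ae_eq
    (Hs.isRealEllTwo_coeff hs (θ' t)) ?_)
  filter_upwards [h1, h2] with x h3 h4
  exact h3.symm.trans h4

/-- Cramer's rule: `perp p ⬝ᵥ q` is the determinant of the system with rows `p` and `q`. -/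
theorem eq_zero_of_dotProduct_eq_zero {w p q : Fin 2 → ℝ} (hpq : perp p ⬝ᵥ q ≠ 0)
    (hp : w ⬝ᵥ p = 0) (hq : w ⬝ᵥ q = 0) : w = 0 := by
  simp only [perp, dotProduct, Fin.sum_univ_two, Matrix.cons_val_zero, Matrix.cons_val_one] at *
  have h0 : w 0 * (-p 1 * q 0 + p 0 * q 1) = 0 := by linear_combination q 1 * hp - p 1 * hq
  have h1 : w 1 * (-p 1 * q 0 + p 0 * q 1) = 0 := by linear_combination p 0 * hq - q 0 * hp
  ext j
  fin_cases j
  · exact (mul_eq_zero.1 h0).resolve_right hpq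
  · exact (mul_eq_zero.1 h1).resolve_right hpq

/-- Flows with the same paired solution coincide. -/
theorem IsPairedSolution.flow_eq {κ T m s : ℝ} (hm : 0 ≤ m) (hs : 1 ≤ s) (hT : 0 < T)
    {θ₀₁ θ₀₂ : Hs s}
    (hθ₀ : ∀ᵐ x ∂torusMeasure, perp (grad θ₀₁.coeff x) ⬝ᵥ grad θ₀₂.coeff x ≠ 0)
    {v v' : Flow m} {Θ : SpaceTimeL2 T × SpaceTimeL2 T}
    (h : IsPairedSolution κ T θ₀₁ θ₀₂ v Θ) (h' : IsPairedSolution κ T θ₀₁ θ₀₂ v' Θ) : v = v' := by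
  have hs0 : 0 ≤ s := zero_le_one.trans hs
  obtain ⟨θ₁, θ₁', h₁, h₁', he₁⟩ := h.1.exists_eqOn hs0 hT h'.1
  obtain ⟨θ₂, θ₂', h₂, h₂', he₂⟩ := h.2.exists_eqOn hs0 hT h'.2
  refine Flow.eq_of_field_ae_eq hm ?_
  filter_upwards [hθ₀, ae_field_dotProduct_grad_eq hm hs hT h₁ h₁' he₁,
    ae_field_dotProduct_grad_eq hm hs hT h₂ h₂' he₂] with x hx hx₁ hx₂
  exact sub_eq_zero.1 (eq_zero_of_dotProduct_eq_zero hx hx₁ hx₂)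

end AdvDiff

end

theorem lemma4p2 (m κ T : ℝ) (hm : 1 < m) (hκ : 0 < κ) (hT : 0 < T)
    (θ₀₁ θ₀₂ : AdvDiff.Hs m)
    (hθ₀ : ∀ᵐ x ∂AdvDiff.torusMeasure,
      AdvDiff.perp (AdvDiff.grad θ₀₁.coeff x) ⬝ᵥ AdvDiff.grad θ₀₂.coeff x ≠ 0) :
    (∀ (v v' : AdvDiff.Flow m) (Θ Θ' : AdvDiff.SpaceTimeL2 T × AdvDiff.SpaceTimeL2 T),
      AdvDiff.IsPairedSolution κ T θ₀₁ θ₀₂ v Θ →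
      AdvDiff.IsPairedSolution κ T θ₀₁ θ₀₂ v' Θ' →
      ‖Θ - Θ'‖ = 0 → v = v') ∧
    (∀ S : AdvDiff.Flow m → AdvDiff.SpaceTimeL2 T × AdvDiff.SpaceTimeL2 T,
      (∀ v, AdvDiff.IsPairedSolution κ T θ₀₁ θ₀₂ v (S v)) → Function.Injective S) := by
  have key : ∀ (v v' : AdvDiff.Flow m) (Θ : AdvDiff.SpaceTimeL2 T × AdvDiff.SpaceTimeL2 T),
      AdvDiff.IsPairedSolution κ T θ₀₁ θ₀₂ v Θ →
      AdvDiff.IsPairedSolution κ T θ₀₁ θ₀₂ v' Θ → v = v' := fun v v' Θ h h' =>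
    h.flow_eq (zero_le_one.trans hm.le) hm.le hT hθ₀ h'
  refine ⟨fun v v' Θ Θ' h h' hΘ => ?_, fun S hS v v' hSv => key v v' (S v) (hS v) ?_⟩
  · rw [← sub_eq_zero.1 (norm_eq_zero.1 hΘ)] at h'
    exact key v v' Θ h h'
  · rw [hSv]
    exact hS v'
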